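/- Let $U=(U_y)_{y\in\mathbb Z}$ and $V=(V_x)_{x\in\mathbb Z}$ be arbitrary sequences with values in $\{-1,1\}$, and let $\omega$ be the directed graph on $\mathbb Z^2$ with edge set \[\omega=\big\{\big((x,y),(x+U_y,\,y+V_x)\big) : (x,y)\in\mathbb Z^2\big\}.\] A cycle of length $n\ge 1$ in $\omega$ is a sequence $a_0,\dots,a_n$ in $\mathbb Z^2$ such that $a_n=a_0$ and $(a_k,a_{k+1})\in\omega$ for $k=0,\dots,n-1$; it is simple if $a_0,\dots,a_{n-1}$ are distinct. A trap is a cycle in $\omega$ of length $2$. Then the only cycles in $\omega$ are traps: every simple cycle in $\omega$ is a trap, and every cycle $a_0,\dots,a_n$ in $\omega$, simple or not, runs through a single trap a whole number of times, i.e. $n$ is even and there is a trap $b_0,b_1,b_2=b_0$ with $a_k=b_0$ for even $k$ and $a_k=b_1$ for odd $k$. -/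

import Mathlib

/-- The directed graph `ω` on `ℤ²`, as a set of directed edges, for orientations `U` of the
horizontal lines and `V` of the vertical lines, with values in `{-1, 1}` (the units of `ℤ`):
each vertex `(x, y)` has exactly one outgoing edge, to `(x + U y, y + V x)`. -/
def orientedDiagonals (U V : ℤ → ℤˣ) : Set ((ℤ × ℤ) × (ℤ × ℤ)) :=
  {e | ∃ x y : ℤ, e = ((x, y), (x + (U y : ℤ), y + (V x : ℤ)))}

/-- A cycle of length `n ≥ 1` in a directed graph `ω`: a finite sequence `a 0, …, a n` of vertices
with `a n = a 0` and every `(a k, a (k + 1))` an edge of `ω`. Vertices may be repeated. -/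
def IsCycle (ω : Set ((ℤ × ℤ) × (ℤ × ℤ))) {n : ℕ} (a : Fin (n + 1) → ℤ × ℤ) : Prop :=
  1 ≤ n ∧ a (Fin.last n) = a 0 ∧ ∀ k : Fin n, (a k.castSucc, a k.succ) ∈ ω

/-- A cycle is simple if `a 0, …, a (n - 1)` are distinct. -/
def IsSimpleCycle (ω : Set ((ℤ × ℤ) × (ℤ × ℤ))) {n : ℕ} (a : Fin (n + 1) → ℤ × ℤ) : Prop :=
  IsCycle ω a ∧ Function.Injective fun k : Fin n => a k.castSucc

/-- A trap is a cycle of length two. -/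
def IsTrap (ω : Set ((ℤ × ℤ) × (ℤ × ℤ))) {n : ℕ} (a : Fin (n + 1) → ℤ × ℤ) : Prop :=
  IsCycle ω a ∧ n = 2

/-! The cross products of consecutive steps, summed around a cycle, measure its total turning, each
right-angle turn counting `±2`. This sum is computed in two ways. In `ω` a step depends only on a
row and a column, so the cross product is a difference of a potential `B x - A y` and the sum
vanishes (`sum_turn_eq_zero`). For a closed path of length at least 3 without repetitions it is
`±8`, a discrete Hopf Umlaufsatz (`sum_turn_ne_zero`): the secant from vertex `i` to vertex `j`
never vanishes on the triangle `i < j` except at the corner `(0, n)`, so its winding along the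
diagonal equals its winding along the two legs, which an extremal starting vertex makes easy to read
off. Hence every periodic orbit has period 2, since period 1 is impossible. -/

/-! ### Winding of secants and total turning -/

/-- The signed number of crossings of the ray `{y = x + ε, x + y > 0}` by a diagonal unit step from
`(a, b)` to `(c, d)`. -/
def rayCrossing (a b c d : ℤ) : ℤ :=
  if 0 < a + b then (if 0 < d - c then 1 else 0) - (if 0 < b - a then 1 else 0) else 0

/-- The number of the direction `(u, v)` in the cyclic order `(-1, 1)`, `(-1, -1)`, `(1, -1)`,
`(1, 1)`. -/
def directionIndex (u v : ℤ) : ℤ :=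
  if u = -1 then (if v = 1 then 0 else 1) else (if v = 1 then 3 else 2)

-- Winding around an elementary square of secants is zero when the origin is not a corner. The
-- parity hypothesis keeps the origin from lying inside the square. The alternative in `h₁` admits
-- the one vanishing secant, from the start to the end of the path.
set_option maxHeartbeats 4000000 in
theorem rayCrossing_square {a b u v u' v' m : ℤ} (hu : u = 1 ∨ u = -1) (hv : v = 1 ∨ v = -1)
    (hu' : u' = 1 ∨ u' = -1) (hv' : v' = 1 ∨ v' = -1) (hm : a + b = 2 * m)
    (h₀ : ¬(a = 0 ∧ b = 0))
    (h₁ : ¬(a + u = 0 ∧ b + v = 0) ∨ (0 ≤ a + b ∧ 0 ≤ b - a ∧ u' + v' ≥ 0 ∧ v' - u' ≥ 0))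
    (h₂ : ¬(a - u' = 0 ∧ b - v' = 0)) (h₃ : ¬(a + u - u' = 0 ∧ b + v - v' = 0)) :
    rayCrossing a b (a + u) (b + v) + rayCrossing (a + u) (b + v) (a + u - u') (b + v - v') =
      rayCrossing a b (a - u') (b - v') +
        rayCrossing (a - u') (b - v') (a + u - u') (b + v - v') := by
  rcases hu with rfl | rfl <;> rcases hv with rfl | rfl <;> rcases hu' with rfl | rfl <;>
    rcases hv' with rfl | rfl <;>
    simp only [rayCrossing, add_sub_add_right_eq_sub, sub_sub_sub_cancel_right, sub_self,
      add_sub_cancel_right, ite_self] <;> (try rfl) <;> (split_ifs <;> omega)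

/-- A quarter turn counts 2 and a full revolution 8. The direction index follows the quarter turns
up to its jump between 3 and 0, which the ray crossing compensates. -/
theorem rayCrossing_turn {u v u' v' : ℤ} (hu : u = 1 ∨ u = -1) (hv : v = 1 ∨ v = -1)
    (hu' : u' = 1 ∨ u' = -1) (hv' : v' = 1 ∨ v' = -1) (h : ¬(u + u' = 0 ∧ v + v' = 0)) :
    8 * (rayCrossing u v (u + u') (v + v') + rayCrossing (u + u') (v + v') u' v') +
      2 * (directionIndex u' v' - directionIndex u v) = u * v' - v * u' := by
  rcases hu with rfl | rfl <;> rcases hv with rfl | rfl <;> rcases hu' with rfl | rfl <;>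
    rcases hv' with rfl | rfl <;> simp [rayCrossing, directionIndex] at h ⊢

/-- A closed sequence of `n ≥ 3` diagonal unit steps without repeated vertices, started at a vertex
that minimizes `(y - x, x + y)` lexicographically, has nonzero total turning. -/
theorem sum_turn_ne_zero {x y u v : ℕ → ℤ} {n : ℕ} (hn : 3 ≤ n)
    (hu : ∀ k, u k = 1 ∨ u k = -1) (hv : ∀ k, v k = 1 ∨ v k = -1)
    (hx : ∀ k, x (k + 1) = x k + u k) (hy : ∀ k, y (k + 1) = y k + v k)
    (hxn : x n = x 0) (hyn : y n = y 0) (hun : u n = u 0) (hvn : v n = v 0)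
    (hinj : ∀ i j, i < j → j ≤ n → ¬(i = 0 ∧ j = n) → ¬(x j - x i = 0 ∧ y j - y i = 0))
    (hmin : ∀ k, y 0 - x 0 < y k - x k ∨ (y 0 - x 0 = y k - x k ∧ x 0 + y 0 ≤ x k + y k)) :
    ∑ i ∈ Finset.range n, (u i * v (i + 1) - v i * u (i + 1)) ≠ 0 := by
  obtain ⟨r, rfl⟩ : ∃ r, n = r + 3 := ⟨n - 3, by omega⟩
  have hpar : ∀ k, ∃ m, x k + y k = x 0 + y 0 + 2 * m := by
    intro k
    induction k with
    | zero => exact ⟨0, by ring⟩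
    | succ k ih =>
      obtain ⟨m, hm⟩ := ih
      rcases hu k with h | h <;> rcases hv k with h' | h' <;> rw [hx, hy, h, h']
      · exact ⟨m + 1, by linarith⟩
      · exact ⟨m, by linarith⟩
      · exact ⟨m, by linarith⟩
      · exact ⟨m - 1, by linarith⟩
  -- `G` moves the head of the secant from `j` to `j + 1`; `K` moves its tail from `i` to `i + 1`.
  let G : ℕ → ℕ → ℤ := fun i j =>
    rayCrossing (x j - x i) (y j - y i) (x (j + 1) - x i) (y (j + 1) - y i)
  let K : ℕ → ℕ → ℤ := fun i j =>
    rayCrossing (x j - x i) (y j - y i) (x j - x (i + 1)) (y j - y (i + 1))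
  have hsq : ∀ i j, i + 1 < j → j + 1 ≤ r + 3 → G i j + K i (j + 1) = K i j + G (i + 1) j := by
    intro i j hij hj
    obtain ⟨mi, hmi⟩ := hpar i
    obtain ⟨mj, hmj⟩ := hpar j
    have e1 : x (j + 1) - x i = x j - x i + u j := by rw [hx]; ring
    have e2 : y (j + 1) - y i = y j - y i + v j := by rw [hy]; ring
    have e3 : x j - x (i + 1) = x j - x i - u i := by rw [hx]; ring
    have e4 : y j - y (i + 1) = y j - y i - v i := by rw [hy]; ring
    have e5 : x (j + 1) - x (i + 1) = x j - x i + u j - u i := by rw [hx, hx]; ring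
    have e6 : y (j + 1) - y (i + 1) = y j - y i + v j - v i := by rw [hy, hy]; ring
    have h0 := hinj i j (by omega) (by omega) (by omega)
    have h2 := hinj (i + 1) j (by omega) (by omega) (by omega)
    have h3 := hinj (i + 1) (j + 1) (by omega) (by omega) (by omega)
    have h1 : ¬(x (j + 1) - x i = 0 ∧ y (j + 1) - y i = 0) ∨
        (0 ≤ (x j - x i) + (y j - y i) ∧ 0 ≤ (y j - y i) - (x j - x i) ∧
          u i + v i ≥ 0 ∧ v i - u i ≥ 0) := by
      by_cases hc : i = 0 ∧ j + 1 = r + 3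
      · obtain ⟨rfl, hj'⟩ := hc
        right
        have m1 := hmin j
        have m2 := hmin 1
        have a1 := hx j
        have a2 := hy j
        have a3 := hx 0
        have a4 := hy 0
        rw [hj', hxn] at a1
        rw [hj', hyn] at a2
        rw [zero_add] at a3 a4
        rcases hu 0 with h | h <;> rcases hv 0 with h' | h' <;>
          rcases hu j with g | g <;> rcases hv j with g' | g' <;> omega
      · exact Or.inl (hinj i (j + 1) (by omega) hj hc)
    simp only [G, K]
    rw [e1, e2] at h1
    rw [e3, e4] at h2
    rw [e5, e6] at h3
    rw [e1, e2, e3, e4, e5, e6]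
    exact rayCrossing_square (m := mj - mi) (hu j) (hv j) (hu i) (hv i) (by linarith) h0 h1 h2 h3
  have hrow : ∀ j, j + 2 ≤ r + 3 → ∀ t, t ≤ j →
      ∑ i ∈ Finset.range t, K i (j + 1) + G t (j + 1) =
        G 0 (j + 1) + ∑ i ∈ Finset.range t, K i (j + 2) := by
    intro j hj t
    induction t with
    | zero => intro _; simp
    | succ t ih =>
      intro ht
      have := ih (by omega)
      have h := hsq t (j + 1) (by omega) (by omega)
      rw [Finset.sum_range_succ, Finset.sum_range_succ]
      linarith
  -- The staircase along the diagonal from `(0, 1)` to `(m, m + 1)` is deformed to the two legs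
  -- through `(0, m + 1)`.
  have hdiag : ∀ m, m + 1 ≤ r + 3 →
      ∑ i ∈ Finset.range m, (G i (i + 1) + K i (i + 2)) =
        ∑ j ∈ Finset.range m, G 0 (j + 1) + ∑ i ∈ Finset.range m, K i (m + 1) := by
    intro m
    induction m with
    | zero => intro _; simp
    | succ m ih =>
      intro hm
      have := ih (by omega)
      have h := hrow m (by omega) m le_rfl
      rw [Finset.sum_range_succ, this, Finset.sum_range_succ, Finset.sum_range_succ]
      linarith
  -- Secants ending at the minimal vertex satisfy `y - x ≤ 0`, so they never cross the ray.
  have hcol : ∑ i ∈ Finset.range (r + 2), K i (r + 2 + 1) = 0 := by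
    refine Finset.sum_eq_zero fun i _ => ?_
    have m1 := hmin i
    have m2 := hmin (i + 1)
    simp only [K, rayCrossing]
    rw [show r + 2 + 1 = r + 3 from rfl, hxn, hyn]
    split_ifs <;> omega
  -- Secants from the minimal vertex have `y - x ≥ 0`, and `x + y > 0` where equality holds, so
  -- every change of sign of `y - x` occurs on the ray and the crossings telescope.
  have hbase : ∀ m, m ≤ r + 1 → ∑ j ∈ Finset.range m, G 0 (j + 1) =
      (if 0 < (y (m + 1) - y 0) - (x (m + 1) - x 0) then 1 else 0) -
        (if 0 < (y 1 - y 0) - (x 1 - x 0) then 1 else 0) := by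
    intro m
    induction m with
    | zero => intro _; simp
    | succ m ih =>
      intro hm
      rw [Finset.sum_range_succ, ih (by omega)]
      have m1 := hmin (m + 1)
      have m2 := hmin (m + 1 + 1)
      have i1 := hinj 0 (m + 1) (by omega) (by omega) (by omega)
      have i2 := hinj 0 (m + 1 + 1) (by omega) (by omega) (by omega)
      have a1 := hx (m + 1)
      have a2 := hy (m + 1)
      have b1 := hu (m + 1)
      have b2 := hv (m + 1)
      simp only [G, rayCrossing]
      split_ifs <;> omega
  have hturn : ∀ i, i < r + 2 → u i * v (i + 1) - v i * u (i + 1) =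
      8 * (G i (i + 1) + K i (i + 2)) +
        2 * (directionIndex (u (i + 1)) (v (i + 1)) - directionIndex (u i) (v i)) := by
    intro i hi
    have h := hinj i (i + 1 + 1) (by omega) (by omega) (by omega)
    have e1 : x (i + 1) - x i = u i := by rw [hx]; ring
    have e2 : y (i + 1) - y i = v i := by rw [hy]; ring
    have e3 : x (i + 1 + 1) - x i = u i + u (i + 1) := by rw [hx, hx]; ring
    have e4 : y (i + 1 + 1) - y i = v i + v (i + 1) := by rw [hy, hy]; ring
    have e5 : x (i + 1 + 1) - x (i + 1) = u (i + 1) := by rw [hx (i + 1)]; ring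
    have e6 : y (i + 1 + 1) - y (i + 1) = v (i + 1) := by rw [hy (i + 1)]; ring
    rw [e3, e4] at h
    simp only [G, K]
    rw [show i + 2 = i + 1 + 1 from rfl, e1, e2, e3, e4, e5, e6]
    exact (rayCrossing_turn (hu _) (hv _) (hu _) (hv _) h).symm
  -- Minimality forces the path to leave upwards and return downwards, and the last step does not
  -- reverse the first. The two remaining cases are the two orientations, with total turning `8` and
  -- `-8`.
  have hG : G 0 (r + 1 + 1) = 0 ∧
      ∑ j ∈ Finset.range (r + 1), G 0 (j + 1) = (if 0 < v 0 - u 0 then 0 else 1) -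
        (if 0 < v 0 - u 0 then 1 else 0) ∧
      ((u 0 = 1 ∧ v 0 = 1 ∧ u (r + 2) = 1 ∧ v (r + 2) = -1) ∨
        (u 0 = -1 ∧ v 0 = 1 ∧ u (r + 2) = -1 ∧ v (r + 2) = -1)) := by
    have m1 := hmin 1
    have m2 := hmin (r + 2)
    have i1 := hinj 1 (r + 2) (by omega) (by omega) (by omega)
    have a1 := hx (r + 2)
    have a2 := hy (r + 2)
    have a3 := hx 0
    have a4 := hy 0
    rw [show r + 2 + 1 = r + 3 from rfl, hxn] at a1
    rw [show r + 2 + 1 = r + 3 from rfl, hyn] at a2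
    rw [zero_add] at a3 a4
    rw [hbase (r + 1) le_rfl]
    simp only [G, rayCrossing]
    rw [show r + 1 + 1 + 1 = r + 3 from rfl, show r + 1 + 1 = r + 2 from rfl, hxn, hyn]
    rcases hu 0 with h | h <;> rcases hv 0 with h' | h' <;>
      rcases hu (r + 2) with g | g <;> rcases hv (r + 2) with g' | g' <;>
      rw [h] at a3 <;> rw [h'] at a4 <;> rw [g] at a1 <;> rw [g'] at a2 <;>
      first
      | (exfalso; omega)
      | (rw [h, h', g, g']; refine ⟨?_, ?_, ?_⟩ <;> (try split_ifs) <;> omega)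
  obtain ⟨hG0, hGs, hcase⟩ := hG
  rw [Finset.sum_range_succ, Finset.sum_congr rfl fun i hi => hturn i (Finset.mem_range.1 hi),
    Finset.sum_add_distrib, ← Finset.mul_sum, ← Finset.mul_sum,
    Finset.sum_range_sub (fun i => directionIndex (u i) (v i)), hdiag (r + 2) le_rfl, hcol,
    Finset.sum_range_succ, hG0, hGs, show r + 2 + 1 = r + 3 from rfl, hun, hvn]
  rcases hcase with ⟨h1, h2, h3, h4⟩ | ⟨h1, h2, h3, h4⟩ <;>
    simp [h1, h2, h3, h4, directionIndex]

/-! ### Vanishing of the turning in `ω` -/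

theorem exists_discrete_primitive (f : ℤ → ℤ) : ∃ A : ℤ → ℤ, ∀ k, A (k + 1) = A k + f k := by
  refine ⟨fun k => ∑ i ∈ Finset.range k.toNat, f i -
    ∑ i ∈ Finset.range (-k).toNat, f (-(i : ℤ) - 1), fun k => ?_⟩
  rcases le_or_gt 0 k with hk | hk
  · obtain ⟨m, rfl⟩ := Int.eq_ofNat_of_zero_le hk
    have h1 : ((m : ℤ) + 1).toNat = m + 1 := by omega
    have h2 : (-((m : ℤ) + 1)).toNat = 0 := by omega
    have h3 : (-(m : ℤ)).toNat = 0 := by omega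
    simp only [h1, h2, h3, Int.toNat_natCast, Finset.sum_range_succ]
    simp
  · obtain ⟨m, rfl⟩ : ∃ m : ℕ, k = -(m : ℤ) - 1 := ⟨(-k - 1).toNat, by omega⟩
    have h1 : (-(m : ℤ) - 1 + 1).toNat = 0 := by omega
    have h2 : (-(m : ℤ) - 1).toNat = 0 := by omega
    have h3 : (-(-(m : ℤ) - 1 + 1)).toNat = m := by omega
    have h4 : (-(-(m : ℤ) - 1)).toNat = m + 1 := by omega
    simp only [h1, h2, h3, h4, Finset.sum_range_succ]
    ring

theorem discrete_primitive_step {A f : ℤ → ℤ} (hA : ∀ k, A (k + 1) = A k + (f k + f (k + 1)))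
    (k : ℤ) {e : ℤ} (he : e = 1 ∨ e = -1) : A (k + e) - A k = e * (f k + f (k + e)) := by
  rcases he with rfl | rfl
  · rw [hA]; ring
  · have := hA (k + -1)
    rw [neg_add_cancel_right] at this
    rw [this]; ring

theorem units_int_cast_eq (u : ℤˣ) : (u : ℤ) = 1 ∨ (u : ℤ) = -1 := by
  rcases Int.units_eq_one_or u with rfl | rfl <;> simp

/-- The head of the edge of `orientedDiagonals U V` that leaves a vertex. -/
def diagonalStep (U V : ℤ → ℤˣ) (p : ℤ × ℤ) : ℤ × ℤ := (p.1 + (U p.2 : ℤ), p.2 + (V p.1 : ℤ))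

theorem mem_orientedDiagonals {U V : ℤ → ℤˣ} {p q : ℤ × ℤ} :
    (p, q) ∈ orientedDiagonals U V ↔ q = diagonalStep U V p := by
  constructor
  · rintro ⟨x, y, h⟩
    obtain ⟨rfl, rfl⟩ := Prod.mk.inj h
    rfl
  · rintro rfl
    exact ⟨p.1, p.2, rfl⟩

/-- With `A`, `B` primitives of `U k + U (k + 1)` and `V k + V (k + 1)`, a step changes `B x - A y`
by exactly the cross product: the terms `U (y i) * V (x i)` cancel. -/
theorem sum_turn_eq_zero (U V : ℤ → ℤˣ) {x y : ℕ → ℤ} {n : ℕ}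
    (hx : ∀ k, x (k + 1) = x k + (U (y k) : ℤ)) (hy : ∀ k, y (k + 1) = y k + (V (x k) : ℤ))
    (hxn : x n = x 0) (hyn : y n = y 0) :
    ∑ i ∈ Finset.range n, ((U (y i) : ℤ) * (V (x (i + 1)) : ℤ) -
      (V (x i) : ℤ) * (U (y (i + 1)) : ℤ)) = 0 := by
  obtain ⟨A, hA⟩ := exists_discrete_primitive fun k => (U k : ℤ) + (U (k + 1) : ℤ)
  obtain ⟨B, hB⟩ := exists_discrete_primitive fun k => (V k : ℤ) + (V (k + 1) : ℤ)
  have h : ∀ i, (U (y i) : ℤ) * (V (x (i + 1)) : ℤ) - (V (x i) : ℤ) * (U (y (i + 1)) : ℤ) =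
      (B (x (i + 1)) - A (y (i + 1))) - (B (x i) - A (y i)) := by
    intro i
    have hA' := discrete_primitive_step (f := fun k => (U k : ℤ)) hA (y i)
      (units_int_cast_eq (V (x i)))
    have hB' := discrete_primitive_step (f := fun k => (V k : ℤ)) hB (x i)
      (units_int_cast_eq (U (y i)))
    rw [← hy] at hA'
    rw [← hx] at hB'
    linear_combination hA' - hB'
  rw [Finset.sum_congr rfl fun i _ => h i, Finset.sum_range_sub (fun i => B (x i) - A (y i)),
    hxn, hyn, sub_self]

/-! ### Periodic orbits and cycles -/

open Function in
theorem minimalPeriod_diagonalStep (U V : ℤ → ℤˣ) {p : ℤ × ℤ}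
    (hp : p ∈ periodicPts (diagonalStep U V)) : minimalPeriod (diagonalStep U V) p = 2 := by
  set T := diagonalStep U V with hT
  set n := minimalPeriod T p with hn
  have hpos : 0 < n := minimalPeriod_pos_of_mem_periodicPts hp
  -- The orbit is finite, so it has a lexicographically minimal vertex from which to start.
  have hlex : ∃ k₀, ∀ k, toLex ((T^[k₀] p).2 - (T^[k₀] p).1, (T^[k₀] p).1 + (T^[k₀] p).2) ≤
      toLex ((T^[k] p).2 - (T^[k] p).1, (T^[k] p).1 + (T^[k] p).2) := by
    obtain ⟨k₀, -, h⟩ := Finset.exists_min_image (Finset.range n)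
      (fun k => toLex ((T^[k] p).2 - (T^[k] p).1, (T^[k] p).1 + (T^[k] p).2))
      ⟨0, Finset.mem_range.2 hpos⟩
    refine ⟨k₀, fun k => ?_⟩
    have := h (k % n) (Finset.mem_range.2 (Nat.mod_lt _ hpos))
    rwa [hn, iterate_mod_minimalPeriod_eq] at this
  obtain ⟨k₀, hk₀⟩ := hlex
  set q := T^[k₀] p with hq
  have hnq : minimalPeriod T q = n := minimalPeriod_apply_iterate hp k₀
  have hstep : ∀ k, T^[k + 1] q = T (T^[k] q) := fun k => iterate_succ_apply' T k q
  let x : ℕ → ℤ := fun k => (T^[k] q).1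
  let y : ℕ → ℤ := fun k => (T^[k] q).2
  have hx : ∀ k, x (k + 1) = x k + (U (y k) : ℤ) := fun k => by
    simp only [x, y, hstep]; rfl
  have hy : ∀ k, y (k + 1) = y k + (V (x k) : ℤ) := fun k => by
    simp only [x, y, hstep]; rfl
  have hper : T^[n] q = q := by rw [← hnq]; exact iterate_minimalPeriod
  have hxn : x n = x 0 := by simp only [x, hper]; rfl
  have hyn : y n = y 0 := by simp only [y, hper]; rfl
  have hsum := sum_turn_eq_zero U V hx hy hxn hyn
  by_contra h2
  have h1 : n ≠ 1 := by
    intro h1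
    have := hx 0
    rw [zero_add, ← hxn, h1] at this
    rcases units_int_cast_eq (U (y 0)) with h | h <;> rw [h] at this <;>
      rw [h1] at hxn <;> omega
  refine sum_turn_ne_zero (n := n) (by omega) (fun k => units_int_cast_eq (U (y k)))
    (fun k => units_int_cast_eq (V (x k))) hx hy hxn hyn (by rw [hyn]) (by rw [hxn]) ?_ ?_ hsum
  · rintro i j hij hj hne ⟨e1, e2⟩
    have he : T^[i] q = T^[j] q := Prod.ext (by simp only [x] at e1; omega)
      (by simp only [y] at e2; omega)
    rcases hj.eq_or_lt with rfl | hj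
    · rw [hper] at he
      have : IsPeriodicPt T i q := he
      have := this.minimalPeriod_le (by omega)
      omega
    · have := iterate_injOn_Iio_minimalPeriod (f := T) (x := q) (Set.mem_Iio.2 (by omega))
        (Set.mem_Iio.2 (by omega)) he
      omega
  · intro k
    have h := hk₀ (k + k₀)
    rw [iterate_add_apply, ← hq, Prod.Lex.toLex_le_toLex] at h
    exact h

theorem IsCycle.eq_iterate {U V : ℤ → ℤˣ} {n : ℕ} {a : Fin (n + 1) → ℤ × ℤ}
    (ha : IsCycle (orientedDiagonals U V) a) (k : Fin (n + 1)) :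
    a k = (diagonalStep U V)^[k] (a 0) := by
  induction k using Fin.induction with
  | zero => rfl
  | succ i ih =>
    rw [mem_orientedDiagonals.1 (ha.2.2 i), ih, Fin.val_succ, Function.iterate_succ_apply']
    rfl

theorem IsCycle.isPeriodicPt {U V : ℤ → ℤˣ} {n : ℕ} {a : Fin (n + 1) → ℤ × ℤ}
    (ha : IsCycle (orientedDiagonals U V) a) :
    Function.IsPeriodicPt (diagonalStep U V) n (a 0) := by
  have := ha.eq_iterate (Fin.last n)
  rw [ha.2.1] at this
  exact this.symm

theorem IsCycle.minimalPeriod_eq_two {U V : ℤ → ℤˣ} {n : ℕ} {a : Fin (n + 1) → ℤ × ℤ}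
    (ha : IsCycle (orientedDiagonals U V) a) :
    Function.minimalPeriod (diagonalStep U V) (a 0) = 2 :=
  minimalPeriod_diagonalStep U V (Function.mk_mem_periodicPts ha.1 ha.isPeriodicPt)

theorem IsCycle.two_dvd {U V : ℤ → ℤˣ} {n : ℕ} {a : Fin (n + 1) → ℤ × ℤ}
    (ha : IsCycle (orientedDiagonals U V) a) : 2 ∣ n :=
  ha.minimalPeriod_eq_two ▸ ha.isPeriodicPt.minimalPeriod_dvd

/-- Every simple cycle in `ω` is a trap, and every cycle (repetitions allowed) consists of running
through one trap `b` a whole number of times. -/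
theorem mainTheorem3 (U V : ℤ → ℤˣ) :
    (∀ (n : ℕ) (a : Fin (n + 1) → ℤ × ℤ),
      IsSimpleCycle (orientedDiagonals U V) a → IsTrap (orientedDiagonals U V) a) ∧
    (∀ (n : ℕ) (a : Fin (n + 1) → ℤ × ℤ), IsCycle (orientedDiagonals U V) a →
      Even n ∧ ∃ b : Fin (2 + 1) → ℤ × ℤ, IsTrap (orientedDiagonals U V) b ∧
        ∀ k : Fin (n + 1), a k = if Even (k : ℕ) then b 0 else b 1) := by
  have hret : ∀ (n : ℕ) (a : Fin (n + 1) → ℤ × ℤ), IsCycle (orientedDiagonals U V) a →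
      (diagonalStep U V)^[2] (a 0) = a 0 := fun n a ha => by
    rw [← ha.minimalPeriod_eq_two]; exact Function.iterate_minimalPeriod
  refine ⟨fun n a ⟨ha, hinj⟩ => ⟨ha, ?_⟩, fun n a ha => ⟨even_iff_two_dvd.2 ha.two_dvd, ?_⟩⟩
  · have hpos := ha.1
    have hdvd := ha.two_dvd
    by_contra hne
    -- An even length other than 2 exceeds 2, so period 2 already repeats the starting vertex at
    -- index 2.
    have h : (⟨2, by omega⟩ : Fin n) = ⟨0, by omega⟩ := by
      refine hinj ?_
      change a (Fin.castSucc ⟨2, _⟩) = a 0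
      rw [ha.eq_iterate]
      exact hret n a ha
    simp at h
  · refine ⟨fun i => (diagonalStep U V)^[i] (a 0), ⟨⟨by norm_num, hret n a ha, fun k => ?_⟩, rfl⟩,
      fun k => ?_⟩
    · rw [mem_orientedDiagonals, ← Function.iterate_succ_apply' (diagonalStep U V)]
      rfl
    · rw [ha.eq_iterate k, ← Function.iterate_mod_minimalPeriod_eq, ha.minimalPeriod_eq_two]
      split_ifs with h
      · rw [Nat.even_iff.1 h]; rfl
      · rw [Nat.not_even_iff.1 h]; rfl
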